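/- \textbf{Conventions.} A permutation group $G\curvearrowright M$ is a countable set $M$ together with a closed subgroup $G$ of $\mathrm{Sym}(M)$ (for the topology of pointwise convergence); it is oligomorphic if $G$ has finitely many orbits on $M^n$ for every $n$. To $G\curvearrowright M$ we associate the canonical first-order structure on $M$ having an $n$-ary relation for each $G$-orbit on $M^n$; its automorphism group is $G$, and its semigroup of elementary self-embeddings is the left-completion $\overline G$ of $G$, i.e. the closure of $G$ in $M^M$. Let $\Omega=[0,1]$ and $\Omega^2=[0,1]^2$ with Lebesgue measure $\mu$. We say that $G$ has \emph{approximable random endomorphisms} if for every measurable $\hat h\colon\Omega^2\to\overline G$ and every $\epsilon>0$ there is a measurable $\hat g\colon\Omega^2\to G$ such that for every measurable $f\colon\Omega\to M$, $$\mu\{(\omega,\omega')\in\Omega^2 : \hat g(\omega,\omega')(f(\omega))\neq \hat h(\omega,\omega')(f(\omega))\}<\epsilon .$$ For permutation groups $G\curvearrowright M$ and $H\curvearrowright N$: the direct product $G\times H$ acts on $M\sqcup N$ by $(g,h)a=ga$ for $a\in M$ and $(g,h)b=hb$ for $b\in N$; the wreath product $G\wr H$ is the group $H\ltimes G^N$ acting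 on $N\times M$ by $(h,g)(b,a)=(hb,g(b)a)$; and $G$ is a finite index supergroup of $H$ if $M=N$, $H\le G$ and $[G:H]<\infty$. \textbf{Proposition.} Let $G\curvearrowright M$ and $H\curvearrowright N$ be oligomorphic permutation groups. Then $G\times H$ and $G\wr H$ are again oligomorphic permutation groups, and: \begin{itemize} \item If $G$ and $H$ have approximable random endomorphisms, then so do $G\times H$ and $G\wr H$. \item If $G$ is a finite index supergroup of $H$ and $H$ has approximable random endomorphisms, then so does $G$. \item If $G$ has approximable random endomorphisms and $G\simeq H$ as topological groups, then $H$ has approximable random endomorphisms. \end{itemize} -/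

import Mathlib

open FirstOrder MeasureTheory
open scoped unitInterval

universe u v

/-! ### Random variables over `Ω = [0,1]` and `Ω² = [0,1]²` -/

/-- `f : S → X` is a random variable with values in the set `X`, seen as a discrete space. -/
def IsRandomVariable {S : Type*} [MeasurableSpace S] {X : Type*} (f : S → X) : Prop :=
  @Measurable S X _ ⊤ f

/-- The distance `d(f, f') = μ⟦f ≠ f'⟧` of two random variables on `Ω² = I × I` with values in a
discrete space. -/
noncomputable def randomDist {X : Type*} (f f' : I × I → X) : ℝ :=
  (volume : Measure (I × I)).real {x | f x ≠ f' x}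

/-- A countable first-order structure `M` has approximable random endomorphisms: for every random
endomorphism `h ∈ End(M)^{Ω²}` (`End(M)` being the elementary self-embeddings) and `ε > 0` there is
a random automorphism `g ∈ Aut(M)^{Ω²}` with `d(g(f), h(f)) < ε` for all `f ∈ M^Ω`, where `M^Ω` is
seen inside `M^{Ω²}` as the random variables that depend on the first coordinate only.

For countable `M`, Borel measurability of a map into `End(M)` or `Aut(M)`, with the topology of
pointwise convergence on the discrete set `M`, is measurability of all its evaluations at points
of `M`. Elements of `Z^{Ω²}` are given by representatives; the condition does not depend on them. -/
def HasApproximableRandomEndomorphisms (L : FirstOrder.Language) (M : Type*) [L.Structure M] : Prop :=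
  ∀ h : I × I → (M ↪ₑ[L] M), (∀ a : M, IsRandomVariable fun x => h x a) →
    ∀ ε : ℝ, 0 < ε →
      ∃ g : I × I → (M ≃[L] M), (∀ a : M, IsRandomVariable fun x => g x a) ∧
        ∀ f : I → M, IsRandomVariable f →
          randomDist (fun x => g x (f x.1)) (fun x => h x (f x.1)) < ε

/-! ### Permutation groups -/

/-- The topology of pointwise convergence on `Sym(X)`, for the discrete set `X`. -/
instance permPointwiseTopology (X : Type*) : TopologicalSpace (Equiv.Perm X) :=
  TopologicalSpace.induced (fun (g : Equiv.Perm X) => (g : X → X))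
    (@Pi.topologicalSpace X (fun _ => X) fun _ => ⊥)

/-- `G` is an oligomorphic permutation group on the (countable) set `X`: a closed subgroup of
`Sym(X)` that has finitely many orbits on `Xⁿ` for every `n`. -/
structure IsOligomorphicPermGroup {X : Type*} (G : Subgroup (Equiv.Perm X)) : Prop where
  isClosed : IsClosed (G : Set (Equiv.Perm X))
  finite_orbits : ∀ n : ℕ, Finite (MulAction.orbitRel.Quotient G (Fin n → X))

/-- The language of the canonical structure of a permutation group `G` on `X`: an `n`-ary relation
symbol for each orbit of `G` on `Xⁿ`. -/
def permLanguage {X : Type u} (G : Subgroup (Equiv.Perm X)) : FirstOrder.Language.{0, u} where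
  Functions := fun _ => Empty
  Relations := fun n => MulAction.orbitRel.Quotient G (Fin n → X)

/-- The canonical structure of a permutation group `G` on `X`. Its automorphism group is `G` when
`G` is closed (`permStructure_aut_iff`) and its endomorphism semigroup is the left-completion of
`G`, that is, the closure of `G` in `X → X` (`permStructure_endo_iff`). -/
instance permStructure {X : Type u} (G : Subgroup (Equiv.Perm X)) :
    (permLanguage G).Structure X where
  funMap := fun f _ => Empty.elim f
  RelMap := fun r v => Quotient.mk (MulAction.orbitRel G _) v = r

/-- A permutation group has approximable random endomorphisms if its canonical structure has. -/
def PermGroupHasARE {X : Type u} (G : Subgroup (Equiv.Perm X)) : Prop :=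
  HasApproximableRandomEndomorphisms (permLanguage G) X

/-- The direct product `G × H`, acting on the disjoint union `M ⊔ N`. -/
def permDirectProduct {M : Type u} {N : Type v} (G : Subgroup (Equiv.Perm M))
    (H : Subgroup (Equiv.Perm N)) : Subgroup (Equiv.Perm (M ⊕ N)) :=
  (G.prod H).map (Equiv.Perm.sumCongrHom M N)

/-- The wreath product `G ≀ H`, acting on `N × M` by `(h, g)(b, a) = (h b, g(b) a)`, where `h ∈ H`
and `g ∈ G^N`. -/
def permWreathProduct {M : Type u} {N : Type v} (G : Subgroup (Equiv.Perm M))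
    (H : Subgroup (Equiv.Perm N)) : Subgroup (Equiv.Perm (N × M)) where
  carrier := {k | ∃ h ∈ H, ∃ g : N → Equiv.Perm M, (∀ b, g b ∈ G) ∧ k = Equiv.prodShear h g}
  one_mem' := ⟨1, H.one_mem, fun _ => 1, fun _ => G.one_mem, by ext <;> rfl⟩
  mul_mem' := by
    rintro _ _ ⟨h, hh, g, hg, rfl⟩ ⟨h', hh', g', hg', rfl⟩
    exact ⟨h * h', H.mul_mem hh hh', fun b => g (h' b) * g' b,
      fun b => G.mul_mem (hg _) (hg' _), by ext <;> rfl⟩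
  inv_mem' := by
    rintro _ ⟨h, hh, g, hg, rfl⟩
    exact ⟨h⁻¹, H.inv_mem hh, fun b => (g (h⁻¹ b))⁻¹, fun b => G.inv_mem (hg _), by ext <;> rfl⟩

/-! ### Automorphisms and endomorphisms of the canonical structure -/

theorem permStructure_exists_of_relMap {X : Type u} (G : Subgroup (Equiv.Perm X)) {f : X → X}
    (hf : ∀ (n : ℕ) (r : (permLanguage G).Relations n) (v : Fin n → X),
      FirstOrder.Language.Structure.RelMap r v → FirstOrder.Language.Structure.RelMap r (f ∘ v)) (s : Finset X) :
    ∃ g ∈ G, ∀ a ∈ s, g a = f a := by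
  have h := hf s.card (Quotient.mk (MulAction.orbitRel G _) fun i => (s.equivFin.symm i : X))
    (fun i => (s.equivFin.symm i : X)) rfl
  obtain ⟨g, hg⟩ := MulAction.orbitRel_apply.1 (Quotient.exact h)
  refine ⟨g, g.2, fun a ha => ?_⟩
  have h' : g • a = f a := by simpa using congrFun hg (s.equivFin ⟨a, ha⟩)
  exact h'

/-- Every element of `G` is an automorphism of the canonical structure. -/
def permStructureAut {X : Type u} (G : Subgroup (Equiv.Perm X)) (g : G) :
    X ≃[permLanguage G] X where
  toEquiv := g.1
  map_fun' := fun f _ => Empty.elim f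
  map_rel' := fun {n} r v => by
    have : Quotient.mk (MulAction.orbitRel G _) ((g.1 : X → X) ∘ v) =
        Quotient.mk (MulAction.orbitRel G (Fin n → X)) v :=
      Quotient.sound (MulAction.orbitRel_apply.2 ⟨g, rfl⟩)
    change Quotient.mk (MulAction.orbitRel G _) ((g.1 : X → X) ∘ v) = r ↔
      Quotient.mk (MulAction.orbitRel G _) v = r
    rw [this]

theorem permStructure_endo_iff {X : Type u} (G : Subgroup (Equiv.Perm X)) (f : X → X) :
    (∃ h : X ↪ₑ[permLanguage G] X, ⇑h = f) ↔ ∀ s : Finset X, ∃ g ∈ G, ∀ a ∈ s, g a = f a := by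
  constructor
  · rintro ⟨h, rfl⟩
    exact permStructure_exists_of_relMap G fun n r v hv => (h.map_rel r v).2 hv
  · intro hf
    refine ⟨⟨f, fun n φ v => ?_⟩, rfl⟩
    classical
    obtain ⟨g, hg, hgf⟩ := hf (Finset.univ.image v)
    have : f ∘ v = permStructureAut G ⟨g, hg⟩ ∘ v :=
      funext fun i => (hgf _ (Finset.mem_image_of_mem v (Finset.mem_univ i))).symm
    rw [this]
    exact FirstOrder.Language.StrongHomClass.realize_formula (permStructureAut G ⟨g, hg⟩) φ

theorem mem_of_isClosed_perm {X : Type u} {G : Subgroup (Equiv.Perm X)}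
    (hG : IsClosed (G : Set (Equiv.Perm X))) {e : Equiv.Perm X}
    (he : ∀ s : Finset X, ∃ g ∈ G, ∀ a ∈ s, g a = e a) : e ∈ G := by
  let _ : TopologicalSpace X := ⊥
  have : DiscreteTopology X := ⟨rfl⟩
  have hind : Topology.IsInducing (fun g : Equiv.Perm X => (g : X → X)) := ⟨rfl⟩
  rw [← SetLike.mem_coe, ← hG.closure_eq, hind.closure_eq_preimage_closure_image,
    Set.mem_preimage, mem_closure_iff]
  intro o ho heo
  obtain ⟨s, u, hu, hsub⟩ := isOpen_pi_iff.1 ho _ heo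
  obtain ⟨g, hg, hge⟩ := he s
  exact ⟨g, hsub fun a ha => by simpa [hge a ha] using (hu a ha).2, g, hg, rfl⟩

theorem permStructure_aut_iff {X : Type u} {G : Subgroup (Equiv.Perm X)}
    (hG : IsClosed (G : Set (Equiv.Perm X))) (e : Equiv.Perm X) :
    (∃ g : X ≃[permLanguage G] X, ⇑g = ⇑e) ↔ e ∈ G := by
  constructor
  · rintro ⟨g, hg⟩
    refine mem_of_isClosed_perm hG fun s => ?_
    rw [← hg]
    exact permStructure_exists_of_relMap G (fun n r v hv => (g.map_rel r v).2 hv) s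
  · intro he
    exact ⟨permStructureAut G ⟨e, he⟩, rfl⟩

/-- For closed `G`, the property in terms of `G` and its left-completion. -/
theorem permGroupHasARE_iff {X : Type u} {G : Subgroup (Equiv.Perm X)}
    (hG : IsClosed (G : Set (Equiv.Perm X))) :
    PermGroupHasARE G ↔
      ∀ h : I × I → X → X, (∀ x, ∀ s : Finset X, ∃ g ∈ G, ∀ a ∈ s, g a = h x a) →
        (∀ a, IsRandomVariable fun x => h x a) → ∀ ε : ℝ, 0 < ε →
        ∃ g : I × I → Equiv.Perm X, (∀ x, g x ∈ G) ∧ (∀ a, IsRandomVariable fun x => g x a) ∧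
          ∀ f : I → X, IsRandomVariable f →
            randomDist (fun x => g x (f x.1)) (fun x => h x (f x.1)) < ε := by
  constructor
  · intro H h hh hm ε hε
    choose k hk using fun x => (permStructure_endo_iff G (h x)).2 (hh x)
    obtain ⟨g, hg, hd⟩ := H k (fun a => by simpa only [hk] using hm a) ε hε
    refine ⟨fun x => (g x).toEquiv, fun x => (permStructure_aut_iff hG _).1 ⟨g x, rfl⟩, hg,
      fun f hf => ?_⟩
    have := hd f hf
    simp only [hk] at this
    exact this
  · intro H h hm ε hε
    obtain ⟨g, hgG, hg, hd⟩ :=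
      H (fun x => h x) (fun x => (permStructure_endo_iff G (h x)).1 ⟨h x, rfl⟩) hm ε hε
    exact ⟨fun x => permStructureAut G ⟨g x, hgG x⟩, hg, hd⟩

/-!
For a closed group `G` both sides of the approximation can be read off from permutations: random
automorphisms are random elements of `G`, random endomorphisms are random elements of the
left-completion of `G`, and a point of the left-completion agrees with some element of `G` on each
finite set.

Random elements of the left-completion of `G × H` split into two independent approximation problems,
those of the left-completion of `G ≀ H` into one problem for `H` and one problem for `G` at every
point of the countable set `N`; the errors add up. If `K ≤ G` has finite index, every `f` in the
left-completion of `G` satisfies `f ∘ r ∈ leftCompletion K` for one of finitely many representatives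
`r`, which can be chosen measurably. A continuous homomorphism extends to the left-completions. If
`φ : G → H` is continuous and surjective and `H` has finitely many orbits, then the value of `φ g`
at any point `b` depends only on the values of `g` on a translate of one finite set `S` that does
not depend on `b`, so passing from `G` to `H` costs a factor `|S|` in the error.
-/

open scoped ENNReal

/-! ### Random variables and random maps -/

section RandomVariables

variable {S : Type*} [MeasurableSpace S] {X Y Z : Type*}

theorem IsRandomVariable.comp {f : S → X} (hf : IsRandomVariable f) (g : X → Y) :
    IsRandomVariable fun x => g (f x) :=
  fun s _ => hf (t := g ⁻¹' s) trivial

theorem IsRandomVariable.measurableSet {f : S → X} (hf : IsRandomVariable f) (p : X → Prop) :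
    MeasurableSet {x | p (f x)} :=
  hf (t := {a | p a}) trivial

theorem IsRandomVariable.of_factorsThrough {f : S → X} {g : S → Y} (hf : IsRandomVariable f)
    (hgf : g.FactorsThrough f) : IsRandomVariable g := by
  intro s _
  have : g ⁻¹' s = f ⁻¹' (f '' (g ⁻¹' s)) := by
    refine (Set.subset_preimage_image f _).antisymm ?_
    rintro x ⟨y, hy, hyx⟩
    rwa [Set.mem_preimage, ← hgf hyx]
  rw [this]
  exact hf trivial

theorem IsRandomVariable.of_comp_injective {f : S → X} {e : X → Y} (he : e.Injective)
    (hf : IsRandomVariable fun x => e (f x)) : IsRandomVariable f :=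
  hf.of_factorsThrough fun _ _ h => he h

theorem isRandomVariable_of_countable [Countable X] {f : S → X}
    (h : ∀ a, MeasurableSet {x | f x = a}) : IsRandomVariable f :=
  letI : MeasurableSpace X := ⊤
  measurable_to_countable' h

theorem IsRandomVariable.pi {ι : Type*} [Finite ι] {X : ι → Type*} [∀ i, Countable (X i)]
    {f : S → ∀ i, X i} (hf : ∀ i, IsRandomVariable fun x => f x i) : IsRandomVariable f := by
  refine isRandomVariable_of_countable fun r => ?_
  simp only [funext_iff, Set.ofPred_forall]
  exact MeasurableSet.iInter fun i => (hf i).measurableSet (· = r i)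

theorem exists_isRandomVariable_forall {ι : Type*} [Countable ι] {p : S → ι → Prop}
    (hp : ∀ x, ∃ i, p x i) (hm : ∀ i, MeasurableSet {x | p x i}) :
    ∃ f : S → ι, IsRandomVariable f ∧ ∀ x, p x (f x) := by
  classical
  rcases isEmpty_or_nonempty S with _ | ⟨⟨x₀⟩⟩
  · exact ⟨isEmptyElim, fun _ _ => Subsingleton.measurableSet, isEmptyElim⟩
  have : Nonempty ι := ⟨(hp x₀).choose⟩
  obtain ⟨e, he⟩ := exists_surjective_nat ι
  have hpe : ∀ x, ∃ n, p x (e n) := fun x => he.exists.1 (hp x)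
  have hfind : IsRandomVariable fun x => Nat.find (hpe x) := measurable_find hpe fun n => hm (e n)
  exact ⟨fun x => e (Nat.find (hpe x)), hfind.comp e, fun x => Nat.find_spec (hpe x)⟩

/-- A random element of `X → Y`, that is, a map into `X → Y` whose evaluations at the points of `X`
are random variables. For countable `X` this is Borel measurability for the topology of pointwise
convergence on the discrete set `Y`. -/
def IsRandomMap (F : S → X → Y) : Prop :=
  ∀ a, IsRandomVariable fun x => F x a

theorem IsRandomMap.eval [Countable X] {F : S → X → Y} (hF : IsRandomMap F) {p : S → X}
    (hp : IsRandomVariable p) : IsRandomVariable fun x => F x (p x) := by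
  intro s _
  have : (fun x => F x (p x)) ⁻¹' s = ⋃ a, {x | p x = a} ∩ {x | F x a ∈ s} := by
    ext x
    simp
  rw [this]
  exact MeasurableSet.iUnion fun a =>
    (hp.measurableSet (· = a)).inter ((hF a).measurableSet (· ∈ s))

theorem IsRandomMap.restrict [Countable Y] {F : S → X → Y} (hF : IsRandomMap F) (s : Finset X) :
    IsRandomVariable fun x => s.restrict (F x) :=
  IsRandomVariable.pi fun a => hF a

theorem IsRandomMap.of_forall_exists_finset [Countable Y] {X' Y' : Type*} {F : S → X → Y}
    {F' : S → X' → Y'} (hF : IsRandomMap F)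
    (h : ∀ b, ∃ s : Finset X, ∀ x y, (∀ a ∈ s, F x a = F y a) → F' x b = F' y b) :
    IsRandomMap F' := by
  intro b
  obtain ⟨s, hs⟩ := h b
  exact (hF.restrict s).of_factorsThrough fun x y hxy =>
    hs x y fun a ha => congrFun hxy ⟨a, ha⟩

theorem IsRandomMap.sumMap {X' Y' : Type*} {F : S → X → Y} {F' : S → X' → Y'} (hF : IsRandomMap F)
    (hF' : IsRandomMap F') : IsRandomMap fun x => Sum.map (F x) (F' x)
  | .inl a => (hF a).comp Sum.inl
  | .inr b => (hF' b).comp Sum.inr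

theorem IsRandomMap.prodShear [Countable Y] {X' Y' : Type*} {F : S → X' → Y'}
    {F' : X' → S → X → Y} (hF : IsRandomMap F) (hF' : ∀ b, IsRandomMap (F' b)) :
    IsRandomMap fun x (p : X' × X) => (F x p.1, F' p.1 x p.2) := fun p =>
  IsRandomMap.eval (F := fun x a => (F x p.1, a)) (fun a => (hF p.1).comp (·, a)) (hF' p.1 p.2)

end RandomVariables

/-! ### Approximation of random maps -/

section Approximation

variable {Ω Ω' : Type*} [MeasurableSpace Ω] [MeasurableSpace Ω'] {μ : Measure (Ω × Ω')}
  {X X' Y Y' : Type*} {ε δ : ℝ≥0∞}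

/-- The random maps `g` and `h` disagree with probability at most `ε` at every random point that
depends on the first coordinate only. -/
def ApproximatesWithin (μ : Measure (Ω × Ω')) (ε : ℝ≥0∞) (g h : Ω × Ω' → X → Y) : Prop :=
  ∀ f : Ω → X, IsRandomVariable f → μ {x | g x (f x.1) ≠ h x (f x.1)} ≤ ε

namespace ApproximatesWithin

theorem mono {g h : Ω × Ω' → X → Y} (hgh : ApproximatesWithin μ δ g h) (hδε : δ ≤ ε) :
    ApproximatesWithin μ ε g h :=
  fun f hf => (hgh f hf).trans hδε

theorem measure_exists_mem_option_le {g h : Ω × Ω' → X → Y} (hgh : ApproximatesWithin μ ε g h)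
    {f : Ω → Option X} (hf : IsRandomVariable f) :
    μ {x | ∃ a ∈ f x.1, g x a ≠ h x a} ≤ ε := by
  rcases isEmpty_or_nonempty X with _ | ⟨⟨a₀⟩⟩
  · simp
  refine (measure_mono ?_).trans (hgh _ (hf.comp (·.getD a₀)))
  rintro x ⟨a, ha, hne⟩
  simpa [Option.mem_def.1 ha] using hne

theorem sumMap {g h : Ω × Ω' → X → Y} {g' h' : Ω × Ω' → X' → Y'}
    (hgh : ApproximatesWithin μ ε g h) (hgh' : ApproximatesWithin μ δ g' h') :
    ApproximatesWithin μ (ε + δ) (fun x => Sum.map (g x) (g' x))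
      (fun x => Sum.map (h x) (h' x)) := by
  intro f hf
  refine (measure_mono ?_).trans <| (measure_union_le _ _).trans <| add_le_add
    (hgh.measure_exists_mem_option_le (hf.comp Sum.getLeft?))
    (hgh'.measure_exists_mem_option_le (hf.comp Sum.getRight?))
  intro x hx
  rcases hfx : f x.1 with a | b
  · exact Or.inl ⟨a, by simp [hfx], by simpa [hfx] using hx⟩
  · exact Or.inr ⟨b, by simp [hfx], by simpa [hfx] using hx⟩

theorem prodShear [Countable X'] {g h : Ω × Ω' → X' → Y'} {g' h' : X' → Ω × Ω' → X → Y}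
    {δ : X' → ℝ≥0∞} (hgh : ApproximatesWithin μ ε g h)
    (hgh' : ∀ b, ApproximatesWithin μ (δ b) (g' b) (h' b)) :
    ApproximatesWithin μ (ε + ∑' b, δ b) (fun x (p : X' × X) => (g x p.1, g' p.1 x p.2))
      (fun x p => (h x p.1, h' p.1 x p.2)) := by
  classical
  intro f hf
  let fiber (b : X') (p : X' × X) : Option X := if p.1 = b then some p.2 else none
  have hfiber (b : X') : μ {x | ∃ a ∈ fiber b (f x.1), g' b x a ≠ h' b x a} ≤ δ b :=
    (hgh' b).measure_exists_mem_option_le (hf.comp (fiber b))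
  refine (measure_mono ?_).trans <| (measure_union_le _ _).trans <| add_le_add
    (hgh _ (hf.comp Prod.fst)) ((measure_iUnion_le _).trans (ENNReal.tsum_le_tsum hfiber))
  intro x hx
  by_cases hfst : g x (f x.1).1 = h x (f x.1).1
  · refine Or.inr (Set.mem_iUnion.2 ⟨(f x.1).1, (f x.1).2, by simp [fiber], fun hsnd => hx ?_⟩)
    exact Prod.ext hfst hsnd
  · exact Or.inl hfst

theorem of_finite_determination {ι : Type*} [Finite ι] {g h : Ω × Ω' → X → Y}
    {g' h' : Ω × Ω' → X' → Y'} (hgh : ApproximatesWithin μ (ε / Nat.card ι) g h)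
    (τ : ι → X' → X)
    (hτ : ∀ x b, (∀ i, g x (τ i b) = h x (τ i b)) → g' x b = h' x b) :
    ApproximatesWithin μ ε g' h' := by
  have := Fintype.ofFinite ι
  intro f hf
  have hsub : {x | g' x (f x.1) ≠ h' x (f x.1)} ⊆
      ⋃ i, {x | g x (τ i (f x.1)) ≠ h x (τ i (f x.1))} := fun x hx => by
    simpa using mt (hτ x (f x.1)) hx
  calc μ {x | g' x (f x.1) ≠ h' x (f x.1)}
      ≤ μ (⋃ i, {x | g x (τ i (f x.1)) ≠ h x (τ i (f x.1))}) := measure_mono hsub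
    _ ≤ ∑ i, μ {x | g x (τ i (f x.1)) ≠ h x (τ i (f x.1))} := measure_iUnion_fintype_le μ _
    _ ≤ ∑ _i : ι, ε / Nat.card ι := Finset.sum_le_sum fun i _ => hgh _ (hf.comp (τ i))
    _ = Nat.card ι * (ε / Nat.card ι) := by simp
    _ ≤ ε := ENNReal.mul_div_le

end ApproximatesWithin

end Approximation

/-! ### The left-completion of a permutation group -/

section LeftCompletion

variable {X : Type*} {G : Subgroup (Equiv.Perm X)}

/-- The left-completion of a permutation group `G` on `X`: the closure of `G` in `X → X` for the
topology of pointwise convergence, written out in terms of agreement on finite sets. -/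
def leftCompletion (G : Subgroup (Equiv.Perm X)) : Set (X → X) :=
  {f | ∀ s : Finset X, ∃ g ∈ G, ∀ a ∈ s, g a = f a}

theorem injective_of_mem_leftCompletion {f : X → X} (hf : f ∈ leftCompletion G) :
    f.Injective := by
  classical
  intro a b hab
  obtain ⟨g, -, hg⟩ := hf {a, b}
  exact g.injective (by rw [hg a (by simp), hg b (by simp), hab])

theorem isOpen_setOf_perm_apply_eq (a b : X) : IsOpen {g : Equiv.Perm X | g a = b} := by
  let _ : TopologicalSpace X := ⊥
  have : DiscreteTopology X := ⟨rfl⟩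
  have hcoe : Continuous fun g : Equiv.Perm X => (g : X → X) := continuous_induced_dom
  exact (isOpen_discrete {b}).preimage ((continuous_apply a).comp hcoe)

theorem exists_finset_forall_mem_of_isOpen {U : Set (Equiv.Perm X)} (hU : IsOpen U)
    {e : Equiv.Perm X} (he : e ∈ U) :
    ∃ s : Finset X, ∀ g : Equiv.Perm X, (∀ a ∈ s, g a = e a) → g ∈ U := by
  let _ : TopologicalSpace X := ⊥
  obtain ⟨V, hV, rfl⟩ := isOpen_induced_iff.1 hU
  obtain ⟨s, w, hw, hwV⟩ := isOpen_pi_iff.1 hV _ he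
  refine ⟨s, fun g hg => hwV fun a ha => ?_⟩
  simpa only [hg a ha] using (hw a ha).2

theorem isClosed_of_forall_mem_leftCompletion
    (h : ∀ e : Equiv.Perm X, ⇑e ∈ leftCompletion G → e ∈ G) :
    IsClosed (G : Set (Equiv.Perm X)) := by
  refine isClosed_of_closure_subset fun e he => h e fun s => ?_
  have hopen : IsOpen (⋂ a ∈ s, {g : Equiv.Perm X | g a = e a}) :=
    isOpen_biInter_finset fun a _ => isOpen_setOf_perm_apply_eq a (e a)
  obtain ⟨g, hgs, hgG⟩ := mem_closure_iff.1 he _ hopen (by simp)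
  exact ⟨g, hgG, by simpa using hgs⟩

theorem IsRandomMap.measurableSet_mem_leftCompletion {S : Type*} [MeasurableSpace S] [Countable X]
    {F : S → X → X} (hF : IsRandomMap F) (G : Subgroup (Equiv.Perm X)) :
    MeasurableSet {x | F x ∈ leftCompletion G} := by
  have : {x | F x ∈ leftCompletion G} =
      ⋂ s : Finset X, {x | ∃ g ∈ G, s.restrict g = s.restrict (F x)} := by
    ext x
    simp [leftCompletion, funext_iff]
  rw [this]
  exact MeasurableSet.iInter fun s =>
    (hF.restrict s).measurableSet fun r => ∃ g ∈ G, s.restrict g = r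

end LeftCompletion

section ApproximableRandomEndomorphisms

variable {X : Type u} {G : Subgroup (Equiv.Perm X)}

theorem PermGroupHasARE.exists_approximatesWithin (hA : PermGroupHasARE G)
    (hG : IsClosed (G : Set (Equiv.Perm X))) {h : I × I → X → X}
    (hh : ∀ x, h x ∈ leftCompletion G) (hm : IsRandomMap h) {ε : ℝ≥0∞} (hε : ε ≠ 0) :
    ∃ g : I × I → Equiv.Perm X, (∀ x, g x ∈ G) ∧ IsRandomMap (fun x => ⇑(g x)) ∧
      ApproximatesWithin volume ε (fun x => ⇑(g x)) h := by
  obtain ⟨δ, -, hδ, hδε⟩ := ENNReal.lt_iff_exists_real_btwn.1 (pos_iff_ne_zero.2 hε)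
  obtain ⟨g, hgG, hgm, hgh⟩ :=
    (permGroupHasARE_iff hG).1 hA h hh hm δ (ENNReal.ofReal_pos.1 hδ)
  refine ⟨g, hgG, hgm, fun f hf => le_trans ?_ hδε.le⟩
  rw [← ofReal_measureReal]
  exact ENNReal.ofReal_le_ofReal (hgh f hf).le

theorem permGroupHasARE_of_forall_exists_approximatesWithin
    (hA : ∀ h : I × I → X → X, (∀ x, h x ∈ leftCompletion G) → IsRandomMap h →
      ∀ ε : ℝ≥0∞, ε ≠ 0 → ∃ g : I × I → Equiv.Perm X, (∀ x, g x ∈ G) ∧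
        IsRandomMap (fun x => ⇑(g x)) ∧ ApproximatesWithin volume ε (fun x => ⇑(g x)) h) :
    PermGroupHasARE G := by
  intro h hm ε hε
  obtain ⟨g, hgG, hgm, hgh⟩ := hA (fun x => h x)
    (fun x => (permStructure_endo_iff G (h x)).1 ⟨h x, rfl⟩) hm (ENNReal.ofReal (ε / 2))
    (ENNReal.ofReal_pos.2 (half_pos hε)).ne'
  refine ⟨fun x => permStructureAut G ⟨g x, hgG x⟩, hgm, fun f hf => ?_⟩
  exact (ENNReal.toReal_le_of_le_ofReal (half_pos hε).le (hgh f hf)).trans_lt (half_lt_self hε)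

end ApproximableRandomEndomorphisms

/-! ### Finiteness of the number of orbits -/

section Orbits

variable {X : Type*} {G : Subgroup (Equiv.Perm X)} {n : ℕ}

theorem exists_fin_subset_range {s : Finset X} (hs : s.card ≤ n) (hne : s.Nonempty) :
    ∃ v : Fin n → X, (s : Set X) ⊆ Set.range v := by
  obtain ⟨a₀, -⟩ := hne
  have hinj : (Fin.castLE hs ∘ s.equivFin).Injective :=
    (Fin.castLE_injective hs).comp s.equivFin.injective
  exact ⟨Function.extend (Fin.castLE hs ∘ s.equivFin) Subtype.val fun _ => a₀,
    fun a ha => ⟨_, hinj.extend_apply _ _ ⟨a, ha⟩⟩⟩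

theorem finite_orbits_iff_exists_finset :
    Finite (MulAction.orbitRel.Quotient G (Fin n → X)) ↔
      ∃ F : Finset X, ∀ s : Finset X, s.card ≤ n → ∃ g ∈ G, ∀ a ∈ s, g a ∈ F := by
  classical
  constructor
  · intro _
    have hreps : (⋃ q : MulAction.orbitRel.Quotient G (Fin n → X), Set.range q.out).Finite :=
      Set.finite_iUnion fun q => Set.finite_range _
    refine ⟨hreps.toFinset, fun s hs => ?_⟩
    rcases s.eq_empty_or_nonempty with rfl | hne
    · exact ⟨1, G.one_mem, by simp⟩
    obtain ⟨v, hv⟩ := exists_fin_subset_range hs hne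
    obtain ⟨g, hg⟩ := MulAction.orbitRel_apply.1
      (Quotient.mk_out (s := MulAction.orbitRel G (Fin n → X)) v)
    refine ⟨g, g.2, fun a ha => ?_⟩
    obtain ⟨i, rfl⟩ := hv ha
    rw [Set.Finite.mem_toFinset, Set.mem_iUnion]
    exact ⟨Quotient.mk _ v, i, (congrFun hg i).symm⟩
  · rintro ⟨F, hF⟩
    refine Finite.of_surjective (α := Fin n → F)
      (fun w => Quotient.mk (MulAction.orbitRel G _) fun i => (w i : X)) fun q => ?_
    obtain ⟨v, rfl⟩ := Quotient.exists_rep q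
    obtain ⟨g, hg, hgF⟩ := hF (Finset.univ.image v) (Finset.card_image_le.trans (by simp))
    refine ⟨fun i => ⟨g (v i), hgF _ (by simp)⟩, Quotient.sound ?_⟩
    exact MulAction.orbitRel_apply.2 ⟨⟨g, hg⟩, rfl⟩

theorem IsOligomorphicPermGroup.finite_orbits_points (hG : IsOligomorphicPermGroup G) :
    Finite (MulAction.orbitRel.Quotient G X) := by
  have := hG.finite_orbits 1
  refine Finite.of_surjective (α := MulAction.orbitRel.Quotient G (Fin 1 → X))
    (Quotient.map (sa := MulAction.orbitRel G (Fin 1 → X)) (sb := MulAction.orbitRel G X)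
      (fun v => v 0) ?_) ?_
  · rintro _ _ ⟨g, rfl⟩
    exact ⟨g, rfl⟩
  · exact fun q => q.inductionOn fun a => ⟨Quotient.mk (MulAction.orbitRel G _) fun _ => a, rfl⟩

end Orbits

/-! ### Direct products -/

section DirectProduct

variable {M : Type u} {N : Type v} {G : Subgroup (Equiv.Perm M)} {H : Subgroup (Equiv.Perm N)}

theorem mem_permDirectProduct {k : Equiv.Perm (M ⊕ N)} :
    k ∈ permDirectProduct G H ↔ ∃ g ∈ G, ∃ h ∈ H, k = Equiv.sumCongr g h := by
  constructor
  · rintro ⟨⟨g, h⟩, ⟨hg, hh⟩, rfl⟩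
    exact ⟨g, hg, h, hh, rfl⟩
  · rintro ⟨g, hg, h, hh, rfl⟩
    exact ⟨(g, h), ⟨hg, hh⟩, rfl⟩

theorem exists_eq_sumMap_of_mem_leftCompletion {k : M ⊕ N → M ⊕ N}
    (hk : k ∈ leftCompletion (permDirectProduct G H)) :
    ∃ g ∈ leftCompletion G, ∃ h ∈ leftCompletion H, k = Sum.map g h := by
  have happrox (s : Finset M) (t : Finset N) : ∃ g ∈ G, ∃ h ∈ H,
      (∀ a ∈ s, k (.inl a) = .inl (g a)) ∧ ∀ b ∈ t, k (.inr b) = .inr (h b) := by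
    obtain ⟨e, he, hek⟩ := hk (s.disjSum t)
    obtain ⟨g, hg, h, hh, rfl⟩ := mem_permDirectProduct.1 he
    exact ⟨g, hg, h, hh, fun a ha => (hek _ (Finset.inl_mem_disjSum.2 ha)).symm,
      fun b hb => (hek _ (Finset.inr_mem_disjSum.2 hb)).symm⟩
  have hleft (a : M) : ∃ a', k (.inl a) = .inl a' := by
    obtain ⟨g, -, -, -, hg, -⟩ := happrox {a} ∅
    exact ⟨g a, hg a (by simp)⟩
  have hright (b : N) : ∃ b', k (.inr b) = .inr b' := by
    obtain ⟨-, -, h, -, -, hh⟩ := happrox ∅ {b}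
    exact ⟨h b, hh b (by simp)⟩
  choose g hg using hleft
  choose h hh using hright
  refine ⟨g, fun s => ?_, h, fun t => ?_, ?_⟩
  · obtain ⟨g', hg', -, -, hkg', -⟩ := happrox s ∅
    exact ⟨g', hg', fun a ha => Sum.inl_injective ((hkg' a ha).symm.trans (hg a))⟩
  · obtain ⟨-, -, h', hh', -, hkh'⟩ := happrox ∅ t
    exact ⟨h', hh', fun b hb => Sum.inr_injective ((hkh' b hb).symm.trans (hh b))⟩
  · ext (a | b)
    · exact hg a
    · exact hh b

theorem isClosed_permDirectProduct (hG : IsClosed (G : Set (Equiv.Perm M)))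
    (hH : IsClosed (H : Set (Equiv.Perm N))) :
    IsClosed (permDirectProduct G H : Set (Equiv.Perm (M ⊕ N))) := by
  refine isClosed_of_forall_mem_leftCompletion fun e he => ?_
  obtain ⟨g, hg, h, hh, hgh⟩ := exists_eq_sumMap_of_mem_leftCompletion he
  obtain ⟨hgbij, hhbij⟩ := Sum.map_bijective.1 (hgh ▸ e.bijective)
  exact mem_permDirectProduct.2 ⟨Equiv.ofBijective g hgbij, mem_of_isClosed_perm hG hg,
    Equiv.ofBijective h hhbij, mem_of_isClosed_perm hH hh, Equiv.ext (congrFun hgh)⟩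

theorem IsOligomorphicPermGroup.directProduct (hG : IsOligomorphicPermGroup G)
    (hH : IsOligomorphicPermGroup H) : IsOligomorphicPermGroup (permDirectProduct G H) := by
  refine ⟨isClosed_permDirectProduct hG.isClosed hH.isClosed, fun n => ?_⟩
  obtain ⟨F, hF⟩ := finite_orbits_iff_exists_finset.1 (hG.finite_orbits n)
  obtain ⟨F', hF'⟩ := finite_orbits_iff_exists_finset.1 (hH.finite_orbits n)
  refine finite_orbits_iff_exists_finset.2 ⟨F.disjSum F', fun s hs => ?_⟩
  have hcard := s.card_toLeft_add_card_toRight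
  obtain ⟨g, hg, hgF⟩ := hF s.toLeft (by lia)
  obtain ⟨h, hh, hhF⟩ := hF' s.toRight (by lia)
  refine ⟨_, mem_permDirectProduct.2 ⟨g, hg, h, hh, rfl⟩, ?_⟩
  rintro (a | b) ha
  · exact Finset.inl_mem_disjSum.2 (hgF a (Finset.mem_toLeft.2 ha))
  · exact Finset.inr_mem_disjSum.2 (hhF b (Finset.mem_toRight.2 ha))

theorem PermGroupHasARE.directProduct (hAG : PermGroupHasARE G) (hAH : PermGroupHasARE H)
    (hG : IsClosed (G : Set (Equiv.Perm M))) (hH : IsClosed (H : Set (Equiv.Perm N))) :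
    PermGroupHasARE (permDirectProduct G H) := by
  refine permGroupHasARE_of_forall_exists_approximatesWithin fun k hk hm ε hε => ?_
  choose g hg h hh hgh using fun x => exists_eq_sumMap_of_mem_leftCompletion (hk x)
  obtain rfl : k = fun x => Sum.map (g x) (h x) := funext hgh
  have hgm : IsRandomMap g := fun a => (hm (.inl a)).of_comp_injective Sum.inl_injective
  have hhm : IsRandomMap h := fun b => (hm (.inr b)).of_comp_injective Sum.inr_injective
  have hε2 : ε / 2 ≠ 0 := (ENNReal.half_pos hε).ne'
  obtain ⟨g', hg'G, hg'm, hg'⟩ := hAG.exists_approximatesWithin hG hg hgm hε2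
  obtain ⟨h', hh'H, hh'm, hh'⟩ := hAH.exists_approximatesWithin hH hh hhm hε2
  refine ⟨fun x => Equiv.sumCongr (g' x) (h' x),
    fun x => mem_permDirectProduct.2 ⟨_, hg'G x, _, hh'H x, rfl⟩, hg'm.sumMap hh'm, ?_⟩
  exact (hg'.sumMap hh').mono (ENNReal.add_halves ε).le

end DirectProduct

/-! ### Wreath products -/

section WreathProduct

variable {M : Type u} {N : Type v} {G : Subgroup (Equiv.Perm M)} {H : Subgroup (Equiv.Perm N)}

theorem exists_eq_prodShear_of_mem_leftCompletion [Nonempty M] {k : N × M → N × M}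
    (hk : k ∈ leftCompletion (permWreathProduct G H)) :
    ∃ h ∈ leftCompletion H, ∃ g : N → M → M, (∀ b, g b ∈ leftCompletion G) ∧
      k = fun p => (h p.1, g p.1 p.2) := by
  classical
  obtain ⟨a₀⟩ := ‹Nonempty M›
  have happrox (s : Finset (N × M)) : ∃ h ∈ H, ∃ g : N → Equiv.Perm M, (∀ b, g b ∈ G) ∧
      ∀ p ∈ s, k p = (h p.1, g p.1 p.2) := by
    obtain ⟨e, ⟨h, hh, g, hg, rfl⟩, hek⟩ := hk s
    exact ⟨h, hh, g, hg, fun p hp => (hek p hp).symm⟩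
  refine ⟨fun b => (k (b, a₀)).1, fun s => ?_, fun b a => (k (b, a)).2, fun b s => ?_,
    funext fun p => ?_⟩
  · obtain ⟨h, hh, g, -, hhg⟩ := happrox (s ×ˢ {a₀})
    exact ⟨h, hh, fun b hb => by simp [hhg (b, a₀) (by simp [hb])]⟩
  · obtain ⟨h, -, g, hg, hhg⟩ := happrox ({b} ×ˢ s)
    exact ⟨g b, hg b, fun a ha => by simp [hhg (b, a) (by simp [ha])]⟩
  · obtain ⟨h, -, g, -, hhg⟩ := happrox {p, (p.1, a₀)}
    simp [hhg p (by simp), hhg (p.1, a₀) (by simp)]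

theorem bijective_of_bijective_prodShear [Nonempty M] {h : N → N} {g : N → M → M}
    (hinj : h.Injective) (hbij : Function.Bijective fun p : N × M => (h p.1, g p.1 p.2)) :
    h.Bijective ∧ ∀ b, (g b).Bijective := by
  refine ⟨⟨hinj, fun b => ?_⟩, fun b => ⟨fun a a' haa' => ?_, fun a => ?_⟩⟩
  · obtain ⟨⟨b', a'⟩, hp⟩ := hbij.surjective (b, Classical.arbitrary M)
    exact ⟨b', congrArg Prod.fst hp⟩
  · have hp : (b, a) = (b, a') := hbij.injective (Prod.ext rfl haa')
    exact congrArg Prod.snd hp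
  · obtain ⟨⟨b', a'⟩, hp⟩ := hbij.surjective (h b, a)
    obtain ⟨hb, ha⟩ := Prod.mk.inj hp
    obtain rfl := hinj hb
    exact ⟨a', ha⟩

theorem isClosed_permWreathProduct (hG : IsClosed (G : Set (Equiv.Perm M)))
    (hH : IsClosed (H : Set (Equiv.Perm N))) :
    IsClosed (permWreathProduct G H : Set (Equiv.Perm (N × M))) := by
  refine isClosed_of_forall_mem_leftCompletion fun e he => ?_
  rcases isEmpty_or_nonempty M with _ | _
  · exact Subsingleton.elim 1 e ▸ Subgroup.one_mem _
  obtain ⟨h, hh, g, hg, hhg⟩ := exists_eq_prodShear_of_mem_leftCompletion he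
  obtain ⟨hhbij, hgbij⟩ :=
    bijective_of_bijective_prodShear (injective_of_mem_leftCompletion hh) (hhg ▸ e.bijective)
  exact ⟨Equiv.ofBijective h hhbij, mem_of_isClosed_perm hH hh,
    fun b => Equiv.ofBijective (g b) (hgbij b), fun b => mem_of_isClosed_perm hG (hg b),
    Equiv.ext (congrFun hhg)⟩

theorem IsOligomorphicPermGroup.wreathProduct (hG : IsOligomorphicPermGroup G)
    (hH : IsOligomorphicPermGroup H) : IsOligomorphicPermGroup (permWreathProduct G H) := by
  classical
  refine ⟨isClosed_permWreathProduct hG.isClosed hH.isClosed, fun n => ?_⟩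
  obtain ⟨F, hF⟩ := finite_orbits_iff_exists_finset.1 (hG.finite_orbits n)
  obtain ⟨F', hF'⟩ := finite_orbits_iff_exists_finset.1 (hH.finite_orbits n)
  refine finite_orbits_iff_exists_finset.2 ⟨F' ×ˢ F, fun s hs => ?_⟩
  obtain ⟨g, hg, hgF⟩ := hF (s.image Prod.snd) (Finset.card_image_le.trans hs)
  obtain ⟨h, hh, hhF⟩ := hF' (s.image Prod.fst) (Finset.card_image_le.trans hs)
  exact ⟨_, ⟨h, hh, fun _ => g, fun _ => hg, rfl⟩, fun p hp => Finset.mem_product.2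
    ⟨hhF _ (Finset.mem_image_of_mem _ hp), hgF _ (Finset.mem_image_of_mem _ hp)⟩⟩

theorem PermGroupHasARE.wreathProduct [Countable M] [Countable N] (hAG : PermGroupHasARE G)
    (hAH : PermGroupHasARE H) (hG : IsClosed (G : Set (Equiv.Perm M)))
    (hH : IsClosed (H : Set (Equiv.Perm N))) : PermGroupHasARE (permWreathProduct G H) := by
  refine permGroupHasARE_of_forall_exists_approximatesWithin fun k hk hm ε hε => ?_
  rcases isEmpty_or_nonempty M with _ | ⟨⟨a₀⟩⟩
  · exact ⟨fun _ => 1, fun _ => Subgroup.one_mem _, fun p => isEmptyElim p.2,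
      fun f _ => isEmptyElim (f 0).2⟩
  have : Nonempty M := ⟨a₀⟩
  choose h hh g hg hhg using fun x => exists_eq_prodShear_of_mem_leftCompletion (hk x)
  obtain rfl : k = fun x p => (h x p.1, g x p.1 p.2) := funext hhg
  have hhm : IsRandomMap h := fun b => (hm (b, a₀)).comp Prod.fst
  have hgm (b : N) : IsRandomMap fun x => g x b := fun a => (hm (b, a)).comp Prod.snd
  have hε2 : ε / 2 ≠ 0 := (ENNReal.half_pos hε).ne'
  obtain ⟨δ, hδ, hδε⟩ := ENNReal.exists_pos_sum_of_countable' hε2 N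
  obtain ⟨h', hh'H, hh'm, hh'⟩ := hAH.exists_approximatesWithin hH hh hhm hε2
  choose g' hg'G hg'm hg' using fun b =>
    hAG.exists_approximatesWithin hG (fun x => hg x b) (hgm b) (hδ b).ne'
  refine ⟨fun x => Equiv.prodShear (h' x) fun b => g' b x,
    fun x => ⟨_, hh'H x, _, fun b => hg'G b x, rfl⟩, hh'm.prodShear hg'm, ?_⟩
  refine (hh'.prodShear hg').mono ?_
  calc ε / 2 + ∑' b, δ b ≤ ε / 2 + ε / 2 := by gcongr
    _ = ε := ENNReal.add_halves ε

end WreathProduct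

/-! ### Finite index supergroups -/

section FiniteIndex

variable {M : Type u} {G K : Subgroup (Equiv.Perm M)}

theorem exists_mul_out_mem (g : G) : ∃ q : G ⧸ K.subgroupOf G, (g * q.out : Equiv.Perm M) ∈ K := by
  obtain ⟨k, hk⟩ := QuotientGroup.mk_out_eq_mul (K.subgroupOf G) g⁻¹
  refine ⟨(g⁻¹ : G), ?_⟩
  rw [hk]
  simpa using Subgroup.mem_subgroupOf.1 k.2

theorem exists_comp_mem_leftCompletion {ι : Type*} [Finite ι] {r : ι → Equiv.Perm M}
    (hr : ∀ g ∈ G, ∃ i, g * r i ∈ K) {f : M → M} (hf : f ∈ leftCompletion G) :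
    ∃ i, f ∘ r i ∈ leftCompletion K := by
  classical
  have := Fintype.ofFinite ι
  by_contra! hcon
  have hbad : ∀ i, ∃ s : Finset M, ∀ g ∈ K, ∃ a ∈ s, g a ≠ f (r i a) := fun i => by
    simpa [leftCompletion] using hcon i
  choose s hs using hbad
  obtain ⟨g, hg, hgf⟩ := hf (Finset.univ.biUnion fun i => (s i).image (r i))
  obtain ⟨i, hi⟩ := hr g hg
  obtain ⟨a, ha, hne⟩ := hs i _ hi
  exact hne (hgf _ (Finset.mem_biUnion.2
    ⟨i, Finset.mem_univ i, Finset.mem_image_of_mem _ ha⟩))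

theorem PermGroupHasARE.of_isFiniteRelIndex [Countable M] (hA : PermGroupHasARE K)
    (hK : IsClosed (K : Set (Equiv.Perm M))) (hKG : K ≤ G) (hfin : K.IsFiniteRelIndex G) :
    PermGroupHasARE G := by
  refine permGroupHasARE_of_forall_exists_approximatesWithin fun h hh hm ε hε => ?_
  let r (q : G ⧸ K.subgroupOf G) : Equiv.Perm M := q.out
  have : (K.subgroupOf G).FiniteIndex := ⟨hfin.relIndex_ne_zero⟩
  obtain ⟨q, hqm, hq⟩ := exists_isRandomVariable_forall
    (p := fun x q => h x ∘ r q ∈ leftCompletion K)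
    (fun x => exists_comp_mem_leftCompletion (fun g hg => exists_mul_out_mem ⟨g, hg⟩) (hh x))
    fun q => IsRandomMap.measurableSet_mem_leftCompletion (fun a => hm (r q a)) K
  obtain ⟨g, hgK, hgm, hg⟩ := hA.exists_approximatesWithin hK hq
    (fun a => hm.eval (hqm.comp fun q => r q a))
    (ENNReal.div_ne_zero.2 ⟨hε, ENNReal.natCast_ne_top (Nat.card (G ⧸ K.subgroupOf G))⟩)
  refine ⟨fun x => g x * (r (q x))⁻¹,
    fun x => G.mul_mem (hKG (hgK x)) (G.inv_mem (q x).out.2),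
    fun a => hgm.eval (hqm.comp fun q => (r q)⁻¹ a), ?_⟩
  refine hg.of_finite_determination (fun q => ⇑(r q)⁻¹) fun x a hxa => ?_
  simpa using hxa (q x)

end FiniteIndex

/-! ### Isomorphisms of topological groups -/

section TopologicalIso

variable {M : Type u} {N : Type v} {G : Subgroup (Equiv.Perm M)} {H : Subgroup (Equiv.Perm N)}

theorem exists_finset_apply_eq_of_forall_eq (φ : G →ₜ* H) (b : N) :
    ∃ T : Finset M, ∀ g g' : G, (∀ a ∈ T, g.1 a = g'.1 a) → (φ g).1 b = (φ g').1 b := by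
  have hopen : IsOpen {g : G | (φ g).1 b = b} :=
    (isOpen_setOf_perm_apply_eq b b).preimage (continuous_subtype_val.comp φ.continuous_toFun)
  obtain ⟨U, hU, hUeq⟩ := isOpen_induced_iff.1 hopen
  have hmem (g : G) : g.1 ∈ U ↔ (φ g).1 b = b := Set.ext_iff.1 hUeq g
  obtain ⟨T, hT⟩ := exists_finset_forall_mem_of_isOpen hU ((hmem 1).2 (by simp))
  refine ⟨T, fun g g' hgg' => ?_⟩
  have hfix : (φ (g⁻¹ * g')).1 b = b :=
    (hmem _).1 (hT _ fun a ha => by simp [← hgg' a ha])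
  have : (φ g).1⁻¹ ((φ g').1 b) = b := by simpa using hfix
  exact (Equiv.Perm.inv_eq_iff_eq.1 this).symm

/-- `Φ` is the extension of `φ` to the left-completions: the value of `Φ f` at a point is that of
`φ g` for every `g ∈ G` that agrees with `f` on a finite set depending on the point only. The values
of `Φ` outside the left-completion of `G` are irrelevant. -/
def IsLeftCompletionExtension (φ : G → H) (Φ : (M → M) → N → N) : Prop :=
  ∀ b, ∃ T : Finset M, ∀ f ∈ leftCompletion G, ∀ g : G,
    (∀ a ∈ T, g.1 a = f a) → (φ g).1 b = Φ f b

theorem exists_isLeftCompletionExtension (φ : G →ₜ* H) :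
    ∃ Φ, IsLeftCompletionExtension φ Φ := by
  choose T hT using exists_finset_apply_eq_of_forall_eq φ
  have hvalue (f : M → M) (b : N) : ∃ c, f ∈ leftCompletion G → ∀ g : G,
      (∀ a ∈ T b, g.1 a = f a) → (φ g).1 b = c := by
    by_cases hf : f ∈ leftCompletion G
    · obtain ⟨g₀, hg₀, hg₀f⟩ := hf (T b)
      exact ⟨(φ ⟨g₀, hg₀⟩).1 b, fun _ g hgf =>
        hT b _ _ fun a ha => (hgf a ha).trans (hg₀f a ha).symm⟩
    · exact ⟨b, fun hf' => absurd hf' hf⟩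
  choose Φ hΦ using hvalue
  exact ⟨Φ, fun b => ⟨T b, fun f hf => hΦ f b hf⟩⟩

namespace IsLeftCompletionExtension

variable {φ : G → H} {Φ : (M → M) → N → N}

theorem exists_finset (hΦ : IsLeftCompletionExtension φ Φ) (s : Finset N) :
    ∃ T : Finset M, ∀ f ∈ leftCompletion G, ∀ g : G, (∀ a ∈ T, g.1 a = f a) →
      ∀ b ∈ s, (φ g).1 b = Φ f b := by
  classical
  choose T hT using hΦ
  exact ⟨s.biUnion T, fun f hf g hgf b hb => hT b f hf g fun a ha =>
    hgf a (Finset.mem_biUnion.2 ⟨b, hb, ha⟩)⟩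

theorem mem_leftCompletion (hΦ : IsLeftCompletionExtension φ Φ) {f : M → M}
    (hf : f ∈ leftCompletion G) : Φ f ∈ leftCompletion H := by
  intro s
  obtain ⟨T, hT⟩ := hΦ.exists_finset s
  obtain ⟨g, hg, hgf⟩ := hf T
  exact ⟨φ ⟨g, hg⟩, (φ ⟨g, hg⟩).2, hT f hf ⟨g, hg⟩ hgf⟩

theorem isRandomMap [Countable M] {S : Type*} [MeasurableSpace S]
    (hΦ : IsLeftCompletionExtension φ Φ) {h : S → M → M} (hh : ∀ x, h x ∈ leftCompletion G)
    (hm : IsRandomMap h) : IsRandomMap fun x => Φ (h x) := by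
  refine hm.of_forall_exists_finset fun b => ?_
  obtain ⟨T, hT⟩ := hΦ b
  refine ⟨T, fun x y hxy => ?_⟩
  obtain ⟨g, hg, hgx⟩ := hh x T
  rw [← hT _ (hh x) ⟨g, hg⟩ hgx]
  exact hT _ (hh y) ⟨g, hg⟩ fun a ha => (hgx a ha).trans (hxy a ha)

theorem apply_eq_of_rightInverse {ψ : H → G} (hφψ : Function.RightInverse φ ψ)
    (hΦ : IsLeftCompletionExtension φ Φ) {a : M} {T : Finset N}
    (hT : ∀ k k' : H, (∀ b ∈ T, k.1 b = k'.1 b) → (ψ k).1 a = (ψ k').1 a) {f : M → M}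
    (hf : f ∈ leftCompletion G) {k : H} (hk : ∀ b ∈ T, k.1 b = Φ f b) : (ψ k).1 a = f a := by
  classical
  obtain ⟨T', hT'⟩ := hΦ.exists_finset T
  obtain ⟨g, hg, hgf⟩ := hf (insert a T')
  have hφg := hT' f hf ⟨g, hg⟩ fun c hc => hgf c (Finset.mem_insert_of_mem hc)
  calc (ψ k).1 a = (ψ (φ ⟨g, hg⟩)).1 a := hT _ _ fun b hb => (hk b hb).trans (hφg b hb).symm
    _ = g a := by rw [hφψ]
    _ = f a := hgf a (Finset.mem_insert_self a T')

end IsLeftCompletionExtension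

theorem exists_finset_translates_apply_eq_of_forall_eq [Finite (MulAction.orbitRel.Quotient H N)]
    (φ : G →ₜ* H) (hφ : Function.Surjective φ) :
    ∃ (S : Finset M) (t : N → G), ∀ b, ∀ g g' : G,
      (∀ a ∈ S, g.1 ((t b).1 a) = g'.1 ((t b).1 a)) → (φ g).1 b = (φ g').1 b := by
  classical
  have := Fintype.ofFinite (MulAction.orbitRel.Quotient H N)
  choose T hT using exists_finset_apply_eq_of_forall_eq φ
  let rep (b : N) : N := Quotient.out (Quotient.mk (MulAction.orbitRel H N) b)
  have hrep (b : N) : ∃ t : G, (φ t).1 (rep b) = b := by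
    obtain ⟨k, hk⟩ := MulAction.orbitRel_apply.1
      ((MulAction.orbitRel H N).symm' (Quotient.mk_out (s := MulAction.orbitRel H N) b))
    obtain ⟨t, rfl⟩ := hφ k
    exact ⟨t, hk⟩
  choose t ht using hrep
  refine ⟨Finset.univ.biUnion fun q : MulAction.orbitRel.Quotient H N => T q.out, t,
    fun b g g' hgg' => ?_⟩
  have := hT (rep b) (g * t b) (g' * t b) fun a ha =>
    hgg' a (Finset.mem_biUnion.2 ⟨_, Finset.mem_univ _, ha⟩)
  simpa [ht] using this

theorem PermGroupHasARE.of_continuousMulEquiv [Countable M] [Countable N]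
    [Finite (MulAction.orbitRel.Quotient H N)] (hA : PermGroupHasARE G)
    (hG : IsClosed (G : Set (Equiv.Perm M))) (φ : G ≃ₜ* H) : PermGroupHasARE H := by
  classical
  obtain ⟨Ψ, hΨ⟩ := exists_isLeftCompletionExtension (φ.symm : H →ₜ* G)
  obtain ⟨S, t, hSt⟩ :=
    exists_finset_translates_apply_eq_of_forall_eq (φ : G →ₜ* H) φ.surjective
  refine permGroupHasARE_of_forall_exists_approximatesWithin fun h hh hm ε hε => ?_
  obtain ⟨g, hgG, hgm, hg⟩ := hA.exists_approximatesWithin hG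
    (fun x => hΨ.mem_leftCompletion (hh x)) (hΨ.isRandomMap hh hm)
    (ENNReal.div_ne_zero.2 ⟨hε, ENNReal.natCast_ne_top (Nat.card S)⟩)
  refine ⟨fun x => φ ⟨g x, hgG x⟩, fun x => (φ ⟨g x, hgG x⟩).2,
    hgm.of_forall_exists_finset fun b => ?_, ?_⟩
  · obtain ⟨T, hT⟩ := exists_finset_apply_eq_of_forall_eq (φ : G →ₜ* H) b
    exact ⟨T, fun x y => hT ⟨g x, hgG x⟩ ⟨g y, hgG y⟩⟩
  · refine hg.of_finite_determination (fun a b => (t b).1 a.1) fun x b hxb => ?_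
    exact hΨ.apply_eq_of_rightInverse φ.apply_symm_apply (T := S.image (t b).1)
      (fun k k' hkk' => hSt b k k' (by simpa using hkk')) (hh x) (by simpa using hxb)

end TopologicalIso

theorem mainTheorem3_general {M : Type u} {N : Type v} [Countable M] [Countable N]
    (G : Subgroup (Equiv.Perm M)) (H : Subgroup (Equiv.Perm N))
    (hG : IsClosed (G : Set (Equiv.Perm M))) (hH : IsClosed (H : Set (Equiv.Perm N))) :
    (IsClosed (permDirectProduct G H : Set (Equiv.Perm (M ⊕ N))) ∧
      IsClosed (permWreathProduct G H : Set (Equiv.Perm (N × M)))) ∧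
    (IsOligomorphicPermGroup G → IsOligomorphicPermGroup H →
      IsOligomorphicPermGroup (permDirectProduct G H) ∧
        IsOligomorphicPermGroup (permWreathProduct G H)) ∧
    (PermGroupHasARE G → PermGroupHasARE H →
      PermGroupHasARE (permDirectProduct G H) ∧ PermGroupHasARE (permWreathProduct G H)) ∧
    (∀ K : Subgroup (Equiv.Perm M), IsClosed (K : Set (Equiv.Perm M)) → K ≤ G →
      K.IsFiniteRelIndex G → PermGroupHasARE K → PermGroupHasARE G) ∧
    (Finite (MulAction.orbitRel.Quotient H N) → PermGroupHasARE G → Nonempty (G ≃ₜ* H) →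
      PermGroupHasARE H) :=
  ⟨⟨isClosed_permDirectProduct hG hH, isClosed_permWreathProduct hG hH⟩,
    fun hoG hoH => ⟨hoG.directProduct hoH, hoG.wreathProduct hoH⟩,
    fun hAG hAH => ⟨hAG.directProduct hAH hG hH, hAG.wreathProduct hAH hG hH⟩,
    fun _ hK hKG hfin hA => hA.of_isFiniteRelIndex hK hKG hfin,
    fun _ hA ⟨φ⟩ => hA.of_continuousMulEquiv hG φ⟩

theorem mainTheorem3 {M : Type u} {N : Type v} [Countable M] [Countable N]
    (G : Subgroup (Equiv.Perm M)) (H : Subgroup (Equiv.Perm N))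
    (hG : IsOligomorphicPermGroup G) (hH : IsOligomorphicPermGroup H) :
    -- `G × H` and `G ≀ H` are again oligomorphic permutation groups
    (IsOligomorphicPermGroup (permDirectProduct G H) ∧
      IsOligomorphicPermGroup (permWreathProduct G H)) ∧
    -- direct products and wreath products
    (PermGroupHasARE G → PermGroupHasARE H →
      PermGroupHasARE (permDirectProduct G H) ∧ PermGroupHasARE (permWreathProduct G H)) ∧
    -- finite index supergroups
    (∀ K : Subgroup (Equiv.Perm M), IsOligomorphicPermGroup K → K ≤ G → K.IsFiniteRelIndex G →
      PermGroupHasARE K → PermGroupHasARE G) ∧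
    -- isomorphism of topological groups
    (PermGroupHasARE G → Nonempty (G ≃ₜ* H) → PermGroupHasARE H) := by
  obtain ⟨-, holig, hprod, hindex, hiso⟩ := mainTheorem3_general G H hG.isClosed hH.isClosed
  exact ⟨holig hG hH, hprod, fun K hK => hindex K hK.isClosed, hiso hH.finite_orbits_points⟩
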